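/- Let $d_n(x)=\sum_{\pi} x^{\mathrm{exc}(\pi)}$ be the classical derangement polynomial, where the sum is over all permutations $\pi$ of $[n]=\{1,\dots,n\}$ without fixed points and $\mathrm{exc}(\pi)=\#\{i\in[n-1] : \pi(i)>i\}$. For a real number $k>0$, let the type $B$ $1/k$-derangement polynomials $d_n^B(x;k)$ be defined by $$\sum_{n\ge 0} d_n^B(x;k)\frac{z^n}{n!}=\left(\frac{(1-x)e^{kz}}{e^{2kxz}-xe^{2kz}}\right)^{1/k},$$ an identity of formal power series in $z$; the power is the formal real power of a series with constant term $1$. For every $n\ge 1$, $$d_n^B(x;1/2)=\frac1x\,d_{n+1}(x)+d_n(x).$$ Moreover, for every $n\ge1$, $$d_n^B(x;1/2)=\sum_{\pi}x^{\mathrm{asc}(\pi)},$$ where the sum is over all permutations $\pi$ of $[n+1]$ that have no succession, i.e. no index $i\in[n]$ with $\pi(i+1)=\pi(i)+1$, and $\mathrm{asc}(\pi)=\#\{i\in[n] : \pi(i)<\pi(i+1)\}$. -/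

import Mathlib

noncomputable section

/-- The `n`-th classical derangement polynomial: the sum of `x ^ exc(π)` over all permutations `π`
of `n` points without fixed points, where `exc(π)` is the number of indices `i` with `π i > i`. -/
def derangementPoly (n : ℕ) : Polynomial ℝ :=
  ∑ π : Equiv.Perm (Fin n) with π ∈ derangements (Fin n),
    Polynomial.X ^ (Finset.univ.filter fun i : Fin n => i < π i).card

/-- The number of ascents of `π`: positions `i` having a next position, with `π i < π (i + 1)`. -/
def ascCount {n : ℕ} (π : Equiv.Perm (Fin n)) : ℕ :=
  (Finset.univ.filter fun i : Fin n => ∃ h : (i : ℕ) + 1 < n, π i < π ⟨(i : ℕ) + 1, h⟩).card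

/-- `i` is a succession of `π`: it has a next position, and `π (i + 1) = π i + 1`
(an equality of natural numbers, so nothing wraps around). -/
def IsSuccession {n : ℕ} (π : Equiv.Perm (Fin n)) (i : Fin n) : Prop :=
  ∃ h : (i : ℕ) + 1 < n, (π ⟨(i : ℕ) + 1, h⟩ : ℕ) = (π i : ℕ) + 1

open Classical in
/-- The permutations of `n` points without successions. -/
def noSuccessions (n : ℕ) : Finset (Equiv.Perm (Fin n)) :=
  Finset.univ.filter fun π => ∀ i, ¬ IsSuccession π i

/-- The formal power `F ^ r` with real exponent `r`, for a power series `F` with constant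
coefficient `1`, by the binomial series: the sum of `binom(r, j) (F - 1) ^ j` over `j`. -/
def seriesPow (F : PowerSeries (RatFunc ℝ)) (r : ℝ) : PowerSeries (RatFunc ℝ) :=
  (PowerSeries.binomialSeries (RatFunc ℝ) r).subst (F - 1)

/-- The formal exponential series `e ^ (a z)` in the variable `z`. -/
def expSeries (a : RatFunc ℝ) : PowerSeries (RatFunc ℝ) :=
  PowerSeries.rescale a (PowerSeries.exp (RatFunc ℝ))

/-- The series `(1 - x) e ^ (k z) / (e ^ (2 k x z) - x e ^ (2 k z))` in `z`, over `ℝ(x)`. The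
denominator has constant coefficient `1 - x ≠ 0`, hence is invertible. -/
def typeBBase (k : ℝ) : PowerSeries (RatFunc ℝ) :=
  PowerSeries.C (1 - RatFunc.X) * expSeries (RatFunc.C k) *
    (expSeries (RatFunc.C (2 * k) * RatFunc.X)
      - PowerSeries.C RatFunc.X * expSeries (RatFunc.C (2 * k)))⁻¹

/-- The type `B` `1/k`-derangement polynomial, as an element of `ℝ(x)`: `n!` times the coefficient
of `z ^ n` in `((1 - x) e ^ (k z) / (e ^ (2 k x z) - x e ^ (2 k z))) ^ (1 / k)`. -/
def typeBDerangement (n : ℕ) (k : ℝ) : RatFunc ℝ :=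
  (n.factorial : RatFunc ℝ) * PowerSeries.coeff n (seriesPow (typeBBase k) (1 / k))

/-- The base series has constant coefficient `1`, so that its formal real powers make sense. -/
theorem typeBBase_constantCoeff (k : ℝ) : PowerSeries.constantCoeff (typeBBase k) = 1 := by
  have h1 : ∀ a : RatFunc ℝ, PowerSeries.constantCoeff (expSeries a) = 1 := by
    intro a
    rw [← PowerSeries.coeff_zero_eq_constantCoeff_apply]
    simp [expSeries, PowerSeries.coeff_rescale]
  have hX : (1 - RatFunc.X : RatFunc ℝ) ≠ 0 := by
    intro h
    have h2 : algebraMap (Polynomial ℝ) (RatFunc ℝ) 1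
        = algebraMap (Polynomial ℝ) (RatFunc ℝ) Polynomial.X := by
      rw [map_one, RatFunc.algebraMap_X]
      exact sub_eq_zero.mp h
    have h3 := congrArg Polynomial.natDegree (RatFunc.algebraMap_injective ℝ h2)
    simp at h3
  simp [typeBBase, h1, mul_inv_cancel₀ hX]

/-- The substitution in the binomial series of the base series is a legitimate one. -/
theorem typeBBase_hasSubst (k : ℝ) : PowerSeries.HasSubst (typeBBase k - 1) :=
  PowerSeries.HasSubst.of_constantCoeff_zero' (by simp [typeBBase_constantCoeff])

end

open Finset Equiv

/-! Weigh each value of a permutation by x (excedance), y (fixed point) or 1, and each step of a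
word by x (ascent), y (succession) or 1. The derivation with δx = x(1 - x), δy = x(1 - y) satisfies
δw = x(1 - w) for all three weights, so on a product of weights it encodes replacing one weight by
1, which is what inserting a new point does. This gives the recurrences `excFixSum_succ` and
`ascSuccSum_succ`, which `mul_ascSuccSum` links by induction; y = 0 then relates ascents to
derangements.

The first recurrence also yields the generating function D = (1 - x)/E of the derangement
polynomials, with E = e^{xz} - x e^z (`derangementPoly_egf_mul`). For k = 1/2 the type B series is
the square of (1 - x)e^{z/2}/E, and differentiating DE = 1 - x shows that x times this square is D'
+ xD. Comparing coefficients gives the first formula. -/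

/-- The weight of a value `b` at position `a` of a permutation: `x` for an excedance,
`y` for a fixed point, and `1` otherwise. -/
def excWeight {S : Type*} [One S] (x y : S) (a b : ℕ) : S :=
  if a = b then y else if a < b then x else 1

/-- The weight of two consecutive letters `a b` of a word: `y` for a succession,
`x` for any other ascent, and `1` for a descent. -/
def stepWeight {S : Type*} [One S] (x y : S) (a b : ℕ) : S :=
  if b = a + 1 then y else if a < b then x else 1

/-- The polynomial of permutations of `n` points by excedances and fixed points. -/
def excFixSum {S : Type*} [CommSemiring S] (x y : S) (n : ℕ) : S :=
  ∑ σ : Perm (Fin n), ∏ i : Fin n, excWeight x y (i : ℕ) (σ i)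

/-- The polynomial of permutations of `n + 1` points by successions and by the ascents which are
not successions. -/
def ascSuccSum {S : Type*} [CommSemiring S] (x y : S) (n : ℕ) : S :=
  ∑ π : Perm (Fin (n + 1)), ∏ i : Fin n, stepWeight x y (π i.castSucc : ℕ) (π i.succ)

/-! ### The logistic derivation on products of weights -/

section Derivation

variable {R S : Type*} [CommRing R] [CommRing S] [Algebra R S] (δ : Derivation R S S) {x y : S}

theorem derivation_excWeight (hx : δ x = x * (1 - x)) (hy : δ y = x * (1 - y)) (a b : ℕ) :
    δ (excWeight x y a b) = x * (1 - excWeight x y a b) := by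
  unfold excWeight
  split_ifs <;> simp [hx, hy]

theorem derivation_stepWeight (hx : δ x = x * (1 - x)) (hy : δ y = x * (1 - y)) (a b : ℕ) :
    δ (stepWeight x y a b) = x * (1 - stepWeight x y a b) := by
  unfold stepWeight
  split_ifs <;> simp [hx, hy]

/-- Sum the relations δ(f i) + x · f i = x, each multiplied by the remaining factors; the terms x ·
f i account for `s.card`. -/
theorem derivation_prod_of_logistic {ι : Type*} [DecidableEq ι] (s : Finset ι) (f : ι → S)
    (hf : ∀ i, δ (f i) = x * (1 - f i)) :
    δ (∏ i ∈ s, f i) + s.card * x * ∏ i ∈ s, f i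
      = x * ∑ i ∈ s, ∏ j ∈ s, if j = i then 1 else f j := by
  induction s using Finset.induction_on with
  | empty => simp
  | insert a s ha ih =>
    have h1 : (∏ j ∈ insert a s, if j = a then 1 else f j) = ∏ j ∈ s, f j := by
      rw [prod_insert ha, if_pos rfl, one_mul]
      exact prod_congr rfl fun j hj => if_neg (ne_of_mem_of_not_mem hj ha)
    have h2 : (∑ i ∈ s, ∏ j ∈ insert a s, if j = i then 1 else f j)
        = f a * ∑ i ∈ s, ∏ j ∈ s, if j = i then 1 else f j := by
      rw [mul_sum]
      refine sum_congr rfl fun i hi => ?_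
      rw [prod_insert ha, if_neg (ne_of_mem_of_not_mem hi ha).symm]
    rw [sum_insert ha, h1, h2, prod_insert ha, card_insert_of_notMem ha, Derivation.leibniz, hf]
    simp only [smul_eq_mul]
    push_cast
    linear_combination f a * ih

end Derivation

/-! ### Recurrence for excedances and fixed points -/

section Excedances

variable {S : Type*} [CommRing S] (x y : S)

theorem prod_excWeight_decomposeFin_zero {n : ℕ} (e : Perm (Fin n)) :
    ∏ i : Fin (n + 1), excWeight x y (i : ℕ) (Perm.decomposeFin.symm (0, e) i)
      = y * ∏ i : Fin n, excWeight x y (i : ℕ) (e i) := by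
  rw [Fin.prod_univ_succ]
  simp [excWeight]

/-- The new point 0 enters the cycle of `e` between `i` and `e i`: the arc leaving `i` gives way to
an excedance at 0 and a drop to 0, of weight 1. -/
theorem prod_excWeight_decomposeFin_succ {n : ℕ} (e : Perm (Fin n)) (i : Fin n) :
    ∏ j : Fin (n + 1), excWeight x y (j : ℕ) (Perm.decomposeFin.symm ((e i).succ, e) j)
      = x * ∏ j : Fin n, if j = i then 1 else excWeight x y (j : ℕ) (e j) := by
  rw [Fin.prod_univ_succ]
  refine congrArg₂ (· * ·) (by simp [excWeight]) ?_
  refine prod_congr rfl fun j _ => ?_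
  rw [Perm.decomposeFin_symm_apply_succ]
  split_ifs with h
  · subst h
    simp [excWeight]
  · rw [swap_apply_of_ne_of_ne (Fin.succ_ne_zero _)]
    · simp [excWeight]
    · simpa using h

theorem excFixSum_succ {R : Type*} [CommRing R] [Algebra R S] (δ : Derivation R S S) {x y : S}
    (hx : δ x = x * (1 - x)) (hy : δ y = x * (1 - y)) (n : ℕ) :
    excFixSum x y (n + 1) = (y + n * x) * excFixSum x y n + δ (excFixSum x y n) := by
  unfold excFixSum
  rw [← Perm.decomposeFin.symm.sum_comp, Fintype.sum_prod_type_right, map_sum, mul_sum,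
    ← sum_add_distrib]
  refine sum_congr rfl fun e _ => ?_
  have h := derivation_prod_of_logistic δ univ
    (fun i : Fin n => excWeight x y (i : ℕ) (e i))
    (fun i => derivation_excWeight δ hx hy _ _)
  -- Reindexing by `e` writes the nonzero image of 0 as `(e i).succ`, where `i` is the point whose
  -- arc is cut.
  rw [Fin.sum_univ_succ, prod_excWeight_decomposeFin_zero, ← e.sum_comp univ _ (by simp)]
  simp only [prod_excWeight_decomposeFin_succ, ← mul_sum]
  rw [← h, card_univ, Fintype.card_fin]
  ring

end Excedances

/-! ### Recurrence for ascents and successions -/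

/-- Inserting a new largest letter at position `p` of a permutation. -/
def insertLast {n : ℕ} (p : Fin (n + 1)) (π : Perm (Fin n)) : Perm (Fin (n + 1)) :=
  (finSuccEquiv' p).trans ((optionCongr π).trans (finSuccEquiv' (Fin.last n)).symm)

theorem insertLast_apply_self {n : ℕ} (p : Fin (n + 1)) (π : Perm (Fin n)) :
    insertLast p π p = Fin.last n := by
  simp [insertLast]

theorem insertLast_apply_succAbove {n : ℕ} (p : Fin (n + 1)) (π : Perm (Fin n)) (i : Fin n) :
    insertLast p π (p.succAbove i) = (π i).castSucc := by
  simp [insertLast]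

theorem insertLast_bijective (n : ℕ) :
    Function.Bijective fun q : Fin (n + 1) × Perm (Fin n) => insertLast q.1 q.2 := by
  rw [Fintype.bijective_iff_injective_and_card]
  constructor
  · rintro ⟨p, π⟩ ⟨q, ρ⟩ h
    have hpq : p = q := by
      apply (insertLast q ρ).injective
      rw [insertLast_apply_self]
      have := insertLast_apply_self p π
      simp only at h
      rwa [h] at this
    subst hpq
    refine Prod.ext rfl (Equiv.ext fun i => ?_)
    have h' := congrArg (fun τ : Perm (Fin (n + 1)) => τ (p.succAbove i)) h
    simpa only [insertLast_apply_succAbove, Fin.castSucc_inj] using h'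
  · simp [Fintype.card_perm, Nat.factorial_succ]

section Successions

variable {S : Type*} [CommRing S] (x y : S)

theorem stepWeight_of_lt {a b : ℕ} (h : b < a) : stepWeight x y a b = 1 := by
  unfold stepWeight
  rw [if_neg (by lia), if_neg (by lia)]

theorem prod_stepWeight_insertLast_zero {n : ℕ} (π : Perm (Fin (n + 1))) :
    ∏ i : Fin (n + 1), stepWeight x y (insertLast 0 π i.castSucc : ℕ) (insertLast 0 π i.succ)
      = ∏ i : Fin n, stepWeight x y (π i.castSucc : ℕ) (π i.succ) := by
  have h (i : Fin (n + 1)) : insertLast 0 π i.succ = (π i).castSucc :=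
    insertLast_apply_succAbove 0 π i
  rw [Fin.prod_univ_succ, Fin.castSucc_zero, insertLast_apply_self, h, stepWeight_of_lt, one_mul]
  · refine prod_congr rfl fun i _ => ?_
    rw [← Fin.succ_castSucc, h, h]
    rfl
  · simpa using Nat.le_of_lt_succ (π 0).isLt

theorem prod_stepWeight_insertLast_last {n : ℕ} (π : Perm (Fin (n + 1))) :
    ∏ i : Fin (n + 1), stepWeight x y (insertLast (Fin.last _) π i.castSucc : ℕ)
        (insertLast (Fin.last _) π i.succ)
      = stepWeight x y (π (Fin.last n)) (n + 1)
        * ∏ i : Fin n, stepWeight x y (π i.castSucc : ℕ) (π i.succ) := by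
  have h (i : Fin (n + 1)) : insertLast (Fin.last _) π i.castSucc = (π i).castSucc := by
    rw [← insertLast_apply_succAbove, Fin.succAbove_last]
  rw [Fin.prod_univ_castSucc, Fin.succ_last, insertLast_apply_self, h, mul_comm]
  congr 1
  refine prod_congr rfl fun i _ => ?_
  rw [Fin.succ_castSucc, h, h]
  rfl

/-- The new maximum cuts the step after position `k`: the step into it is an ascent, the step out of
it a descent of weight 1. -/
theorem prod_stepWeight_insertLast_middle {n : ℕ} (π : Perm (Fin (n + 1))) (k : Fin n) :
    ∏ i : Fin (n + 1), stepWeight x y (insertLast k.succ.castSucc π i.castSucc : ℕ)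
        (insertLast k.succ.castSucc π i.succ)
      = stepWeight x y (π k.castSucc) (n + 1)
        * ∏ i : Fin n, if i = k then 1 else stepWeight x y (π i.castSucc : ℕ) (π i.succ) := by
  have hlow (i : Fin (n + 1)) (hi : i ≤ k.castSucc) :
      insertLast k.succ.castSucc π i.castSucc = (π i).castSucc := by
    rw [← insertLast_apply_succAbove k.succ.castSucc, Fin.succAbove_castSucc_of_lt]
    rw [Fin.lt_def]; rw [Fin.le_def] at hi; simp at hi ⊢; lia
  have hhigh (i : Fin (n + 1)) (hi : k.succ ≤ i) :
      insertLast k.succ.castSucc π i.succ = (π i).castSucc := by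
    rw [← insertLast_apply_succAbove k.succ.castSucc, Fin.succAbove_castSucc_of_le _ _ hi]
  have hk : stepWeight x y (insertLast k.succ.castSucc π k.succ.castSucc : ℕ)
      (insertLast k.succ.castSucc π k.succ.succ) = 1 := by
    rw [insertLast_apply_self, hhigh _ le_rfl]
    exact stepWeight_of_lt _ _ (by simpa using Nat.le_of_lt_succ (π k.succ).isLt)
  rw [Fin.prod_univ_succAbove _ k.succ, hk, one_mul,
    ← mul_prod_erase univ _ (mem_univ k),
    ← mul_prod_erase univ (fun i => if i = k then 1 else _) (mem_univ k), if_pos rfl, one_mul]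
  congr 1
  · rw [Fin.succAbove_succ_self, hlow _ le_rfl, Fin.succ_castSucc, insertLast_apply_self]
    rfl
  · refine prod_congr rfl fun i hi => ?_
    have hik : i ≠ k := ne_of_mem_erase hi
    rw [if_neg hik]
    rcases lt_or_gt_of_ne hik with h | h
    · rw [Fin.succAbove_succ_of_le _ _ h.le, hlow _ (by simpa using h.le), Fin.succ_castSucc,
        hlow _ (by rw [Fin.le_def]; simpa using h)]
      rfl
    · rw [Fin.succAbove_succ_of_lt _ _ h, hhigh _ (by simpa using h.le),
        ← Fin.succ_castSucc i, hhigh _ (by rw [Fin.le_def]; simpa using h)]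
      rfl

/-- Only the former maximum forms a succession with the new one, so the correction y - x occurs once
among all insertions. -/
theorem stepWeight_apply_last {n : ℕ} (a : Fin (n + 1)) :
    stepWeight x y (a : ℕ) (n + 1) = x + if a = Fin.last n then y - x else 0 := by
  unfold stepWeight
  by_cases h : a = Fin.last n
  · simp [h]
  · have : (a : ℕ) < n := Fin.lt_last_iff_ne_last.mpr h
    rw [if_neg (by lia), if_pos (by lia), if_neg h, add_zero]

/-- Replacing the weight of the step after the largest letter by `1` does not change it. -/
theorem prod_stepWeight_erase_max {n : ℕ} (π : Perm (Fin (n + 1))) (k : Fin n)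
    (hk : π k.castSucc = Fin.last n) :
    (∏ i : Fin n, if i = k then 1 else stepWeight x y (π i.castSucc : ℕ) (π i.succ))
      = ∏ i : Fin n, stepWeight x y (π i.castSucc : ℕ) (π i.succ) := by
  refine prod_congr rfl fun i _ => ?_
  split_ifs with h
  · subst h
    rw [stepWeight_of_lt]
    rw [hk, ← Fin.lt_def, Fin.lt_last_iff_ne_last, ← hk, Ne, π.injective.eq_iff]
    exact Fin.castSucc_lt_succ.ne'
  · rfl

theorem sum_prod_stepWeight_insertLast {n : ℕ} (π : Perm (Fin (n + 1))) :
    ∑ p : Fin (n + 2), ∏ i : Fin (n + 1),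
        stepWeight x y (insertLast p π i.castSucc : ℕ) (insertLast p π i.succ)
      = (1 + y) * ∏ i : Fin n, stepWeight x y (π i.castSucc : ℕ) (π i.succ)
        + x * ∑ k : Fin n, ∏ i : Fin n,
          if i = k then 1 else stepWeight x y (π i.castSucc : ℕ) (π i.succ) := by
  rw [Fin.sum_univ_succ, Fin.sum_univ_castSucc, Fin.succ_last, prod_stepWeight_insertLast_zero,
    prod_stepWeight_insertLast_last]
  simp only [Fin.succ_castSucc, prod_stepWeight_insertLast_middle]
  set w := ∏ i : Fin n, stepWeight x y (π i.castSucc : ℕ) (π i.succ) with hw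
  -- Behind the former maximum the cut step was a descent of weight 1, so the correction multiplies
  -- the full product `w`.
  have hmax (k : Fin n) : stepWeight x y (π k.castSucc) (n + 1)
      * (∏ i : Fin n, if i = k then 1 else stepWeight x y (π i.castSucc : ℕ) (π i.succ))
      = x * (∏ i : Fin n, if i = k then 1 else stepWeight x y (π i.castSucc : ℕ) (π i.succ))
        + (if π k.castSucc = Fin.last n then y - x else 0) * w := by
    rw [stepWeight_apply_last, add_mul]
    split_ifs with h
    · rw [prod_stepWeight_erase_max x y π k h]
    · simp
  have hsum : (∑ k : Fin n, if π k.castSucc = Fin.last n then y - x else 0)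
      + (if π (Fin.last n) = Fin.last n then y - x else 0) = y - x := by
    rw [← Fin.sum_univ_castSucc (fun k => if π k = Fin.last n then y - x else 0),
      π.sum_comp univ (fun a => if a = Fin.last n then y - x else 0) (by simp)]
    simp
  rw [sum_congr rfl fun k _ => hmax k, sum_add_distrib, ← mul_sum, ← sum_mul,
    stepWeight_apply_last]
  linear_combination w * hsum

theorem ascSuccSum_succ {R : Type*} [CommRing R] [Algebra R S] (δ : Derivation R S S) {x y : S}
    (hx : δ x = x * (1 - x)) (hy : δ y = x * (1 - y)) (n : ℕ) :
    ascSuccSum x y (n + 1) = (1 + y + n * x) * ascSuccSum x y n + δ (ascSuccSum x y n) := by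
  unfold ascSuccSum
  rw [← (insertLast_bijective (n + 1)).sum_comp, Fintype.sum_prod_type_right, map_sum, mul_sum,
    ← sum_add_distrib]
  refine sum_congr rfl fun π _ => ?_
  have h := derivation_prod_of_logistic δ univ
    (fun i : Fin n => stepWeight x y (π i.castSucc : ℕ) (π i.succ))
    (fun i => derivation_stepWeight δ hx hy _ _)
  rw [sum_prod_stepWeight_insertLast, ← h, card_univ, Fintype.card_fin]
  ring

theorem mul_ascSuccSum {R : Type*} [CommRing R] [Algebra R S] (δ : Derivation R S S) {x y : S}
    (hx : δ x = x * (1 - x)) (hy : δ y = x * (1 - y)) (n : ℕ) :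
    x * ascSuccSum x y n = excFixSum x y (n + 1) + (x - y) * excFixSum x y n := by
  induction n with
  | zero => simp [ascSuccSum, excFixSum, excWeight]
  | succ n ih =>
    have h1 := excFixSum_succ δ hx hy n
    have h2 := excFixSum_succ δ hx hy (n + 1)
    have h3 := ascSuccSum_succ δ hx hy n
    have h4 := congrArg δ ih
    simp only [Derivation.leibniz, map_add, map_sub, smul_eq_mul, hx, hy] at h4
    push_cast at h2
    linear_combination x * h3 - h2 + h4 + (y + n * x + x) * ih - (x - y) * h1

end Successions

/-! ### From the recurrence to the exponential generating function -/

section PowerSeriesEquation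

open PowerSeries

/-- A derivation of the coefficient ring, applied to a power series coefficientwise. -/
noncomputable def PowerSeries.coeffDerivation {R S : Type*} [CommRing R] [CommRing S] [Algebra R S]
    (δ : Derivation R S S) (f : PowerSeries S) : PowerSeries S :=
  PowerSeries.mk fun n => δ (coeff n f)

theorem PowerSeries.coeffDerivation_mul {R S : Type*} [CommRing R] [CommRing S] [Algebra R S]
    (δ : Derivation R S S) (f g : PowerSeries S) :
    coeffDerivation δ (f * g) = f * coeffDerivation δ g + coeffDerivation δ f * g := by
  ext n
  simp only [coeffDerivation, coeff_mk, coeff_mul, map_add, map_sum, Derivation.leibniz,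
    smul_eq_mul, sum_add_distrib]
  congr 1
  exact sum_congr rfl fun _ _ => mul_comm _ _

theorem PowerSeries.coeffDerivation_sub {R S : Type*} [CommRing R] [CommRing S] [Algebra R S]
    (δ : Derivation R S S) (f g : PowerSeries S) :
    coeffDerivation δ (f - g) = coeffDerivation δ f - coeffDerivation δ g := by
  ext n
  simp [coeffDerivation]

theorem PowerSeries.coeffDerivation_C {R S : Type*} [CommRing R] [CommRing S] [Algebra R S]
    (δ : Derivation R S S) (a : S) : coeffDerivation δ (C a) = C (δ a) := by
  ext n
  simp only [coeffDerivation, coeff_mk, coeff_C]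
  split_ifs <;> simp

theorem PowerSeries.coeff_X_mul_derivative {S : Type*} [CommRing S] (f : PowerSeries S) (n : ℕ) :
    coeff n (X * derivative S f) = n * coeff n f := by
  cases n with
  | zero => simp
  | succ n => rw [coeff_succ_X_mul, coeff_derivative]; push_cast; ring

section LinearExponential

variable {S : Type*} [CommRing S] [Algebra ℚ S]

theorem algebraMap_one_div_factorial_succ (n : ℕ) :
    algebraMap ℚ S (1 / (n + 1).factorial) * (n + 1) = algebraMap ℚ S (1 / n.factorial) := by
  rw [← map_natCast (algebraMap ℚ S) n, ← map_one (algebraMap ℚ S), ← map_add, ← map_mul]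
  congr 1
  rw [Nat.factorial_succ]
  push_cast
  field_simp

theorem PowerSeries.constantCoeff_rescale_exp (a : S) :
    constantCoeff (rescale a (exp S)) = 1 := by
  rw [← coeff_zero_eq_constantCoeff_apply]
  simp [coeff_rescale]

theorem PowerSeries.derivative_rescale_exp (a : S) :
    derivative S (rescale a (exp S)) = C a * rescale a (exp S) := by
  ext n
  rw [coeff_derivative, coeff_C_mul, coeff_rescale, coeff_rescale, coeff_exp, coeff_exp]
  rw [mul_assoc, algebraMap_one_div_factorial_succ]
  ring

theorem PowerSeries.coeffDerivation_rescale_exp (δ : Derivation ℚ S S) (a : S) :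
    coeffDerivation δ (rescale a (exp S)) = X * C (δ a) * rescale a (exp S) := by
  ext n
  rw [mul_assoc]
  cases n with
  | zero => simp [coeffDerivation]
  | succ n =>
    rw [coeff_succ_X_mul, coeff_C_mul]
    simp only [coeffDerivation, coeff_mk, coeff_rescale, coeff_exp, Derivation.leibniz,
      Derivation.leibniz_pow, Derivation.map_algebraMap, smul_eq_mul, nsmul_eq_mul]
    push_cast
    rw [← algebraMap_one_div_factorial_succ n]
    simp
    ring

/-- The solution of the first order equation satisfied by the Eulerian exponential generating
function is determined by its constant coefficient. -/
theorem PowerSeries.eq_C_of_transport_equation [IsAddTorsionFree S] (δ : Derivation ℚ S S) {x : S}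
    (hx : δ x = x * (1 - x)) (P : PowerSeries S) (h0 : coeff 0 P = 1 - x)
    (hP : (1 - C x * X) * derivative S P - coeffDerivation δ P = C x * P) : P = C (1 - x) := by
  have hc (n : ℕ) : coeff (n + 1) P * (n + 1) = x * coeff n P + δ (coeff n P)
      + x * (n * coeff n P) := by
    have h := congrArg (coeff n) hP
    rw [sub_mul, one_mul, mul_assoc, map_sub, map_sub, coeff_C_mul, coeff_C_mul, coeff_derivative,
      coeffDerivation, coeff_mk] at h
    rw [coeff_X_mul_derivative] at h
    linear_combination h
  -- By `hc` one vanishing coefficient forces the next to vanish; the first vanishes because x(1 -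
  -- x) + δ(1 - x) = 0.
  have hz (n : ℕ) : coeff (n + 1) P = 0 := by
    have key : ∀ m : ℕ, coeff (m + 1) P * (m + 1) = 0 → coeff (m + 1) P = 0 := by
      intro m h
      have h2 : (m + 1) • coeff (m + 1) P = 0 := by
        rw [nsmul_eq_mul, mul_comm]
        exact_mod_cast h
      exact (smul_eq_zero_iff_right (Nat.succ_ne_zero m)).mp h2
    induction n with
    | zero =>
      apply key
      rw [hc 0, h0]
      simp [hx]
    | succ n ih =>
      apply key
      rw [hc (n + 1), ih]
      simp
  ext n
  cases n with
  | zero => rw [h0]; simp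
  | succ n => rw [hz, coeff_C, if_neg (Nat.succ_ne_zero n)]

end LinearExponential

/-- A sequence with the Eulerian recurrence has the Eulerian exponential generating function. -/
theorem egf_mul_of_eulerian_recurrence {S : Type*} [CommRing S] [Algebra ℚ S] [IsAddTorsionFree S]
    (δ : Derivation ℚ S S) {x y : S} (hx : δ x = x * (1 - x)) (hy : δ y = x * (1 - y))
    (A : ℕ → S) (hA0 : A 0 = 1) (hA : ∀ n : ℕ, A (n + 1) = (y + n * x) * A n + δ (A n)) :
    (PowerSeries.mk fun n => algebraMap ℚ S (1 / n.factorial) * A n)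
        * (rescale (x - y) (exp S) - C x * rescale (1 - y) (exp S)) = C (1 - x) := by
  set F : PowerSeries S := PowerSeries.mk fun n => algebraMap ℚ S (1 / n.factorial) * A n with hF
  have hFe : (1 - C x * X) * derivative S F - coeffDerivation δ F = C y * F := by
    ext n
    rw [sub_mul, one_mul, mul_assoc, map_sub, map_sub, coeff_C_mul, coeff_C_mul, coeffDerivation,
      coeff_mk]
    rw [coeff_X_mul_derivative, coeff_derivative, hF, coeff_mk, coeff_mk, hA n, Derivation.leibniz,
      Derivation.map_algebraMap, smul_zero, add_zero, smul_eq_mul,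
      ← algebraMap_one_div_factorial_succ n]
    ring
  apply eq_C_of_transport_equation δ hx
  · rw [coeff_zero_eq_constantCoeff_apply, map_mul, ← coeff_zero_eq_constantCoeff_apply, hF,
      coeff_mk, hA0, ← coeff_zero_eq_constantCoeff_apply]
    simp [constantCoeff_rescale_exp]
  -- The second factor E satisfies (1 - xz)E' - δE = (x - y)E; together with `hFe`, the product has
  -- the factor y + (x - y) = x.
  · rw [Derivation.leibniz, coeffDerivation_mul, coeffDerivation_sub, coeffDerivation_mul, map_sub,
      Derivation.leibniz, derivative_rescale_exp, derivative_rescale_exp,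
      coeffDerivation_rescale_exp, coeffDerivation_rescale_exp, coeffDerivation_C, derivative_C]
    simp only [smul_eq_mul, hx, hy, map_sub, map_mul, map_one, Derivation.map_one_eq_zero]
    simp only [map_zero]
    linear_combination (rescale (x - y) (exp S) - C x * rescale (1 - y) (exp S)) * hFe

end PowerSeriesEquation

/-! ### Setting y = 0 -/

section Specialization

variable {S T : Type*} [CommSemiring S] [CommSemiring T]

theorem map_excFixSum (φ : S →+* T) (x y : S) (n : ℕ) :
    φ (excFixSum x y n) = excFixSum (φ x) (φ y) n := by
  simp only [excFixSum, map_sum, map_prod]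
  refine sum_congr rfl fun σ _ => prod_congr rfl fun i _ => ?_
  unfold excWeight
  split_ifs <;> simp

theorem map_ascSuccSum (φ : S →+* T) (x y : S) (n : ℕ) :
    φ (ascSuccSum x y n) = ascSuccSum (φ x) (φ y) n := by
  simp only [ascSuccSum, map_sum, map_prod]
  refine sum_congr rfl fun σ _ => prod_congr rfl fun i _ => ?_
  unfold stepWeight
  split_ifs <;> simp

theorem excFixSum_X_zero (n : ℕ) : excFixSum (Polynomial.X : Polynomial ℝ) 0 n
    = derangementPoly n := by
  unfold excFixSum derangementPoly
  rw [sum_filter]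
  refine sum_congr rfl fun σ _ => ?_
  split_ifs with h
  · rw [card_filter, ← prod_pow_eq_pow_sum]
    refine prod_congr rfl fun i _ => ?_
    have hi : (i : ℕ) ≠ σ i := fun hi => h i (Fin.ext hi.symm)
    unfold excWeight
    rw [if_neg hi]
    by_cases hlt : i < σ i
    · rw [if_pos (Fin.lt_def.mp hlt), if_pos hlt, pow_one]
    · rw [if_neg (mt Fin.lt_def.mpr hlt), if_neg hlt, pow_zero]
  · obtain ⟨i, hi⟩ : ∃ i, σ i = i := by simpa [derangements] using h
    exact prod_eq_zero (mem_univ i) (by simp [excWeight, hi])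

theorem ascCount_eq {n : ℕ} (π : Perm (Fin (n + 1))) :
    ascCount π = (univ.filter fun i : Fin n => π i.castSucc < π i.succ).card := by
  unfold ascCount
  rw [card_filter, card_filter, Fin.sum_univ_castSucc, if_neg (by simp), add_zero]
  refine sum_congr rfl fun i _ => if_congr ⟨fun ⟨_, h⟩ => h, fun h => ⟨by simp, h⟩⟩ rfl rfl

theorem ascSuccSum_X_zero (n : ℕ) : ascSuccSum (Polynomial.X : Polynomial ℝ) 0 n
    = ∑ π ∈ noSuccessions (n + 1), Polynomial.X ^ ascCount π := by
  classical
  unfold ascSuccSum noSuccessions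
  rw [sum_filter]
  refine sum_congr rfl fun π _ => ?_
  split_ifs with h
  · rw [ascCount_eq, card_filter, ← prod_pow_eq_pow_sum]
    refine prod_congr rfl fun i _ => ?_
    have hi : (π i.succ : ℕ) ≠ π i.castSucc + 1 := fun hi => h i.castSucc ⟨by simp, hi⟩
    unfold stepWeight
    rw [if_neg hi]
    by_cases hlt : π i.castSucc < π i.succ
    · rw [if_pos (Fin.lt_def.mp hlt), if_pos hlt, pow_one]
    · rw [if_neg (mt Fin.lt_def.mpr hlt), if_neg hlt, pow_zero]
  · push Not at h
    obtain ⟨i, hi, hs⟩ := h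
    refine prod_eq_zero (mem_univ (⟨i, by lia⟩ : Fin n)) ?_
    unfold stepWeight
    exact if_pos hs

end Specialization

/-! ### Universal identities in ℚ[x, y] and their evaluation -/

section Universal

open MvPolynomial

/-- The logistic derivation `x ↦ x (1 - x)`, `y ↦ x (1 - y)` of `ℚ[x, y]`. -/
noncomputable def logisticDerivation :
    Derivation ℚ (MvPolynomial (Fin 2) ℚ) (MvPolynomial (Fin 2) ℚ) :=
  mkDerivation ℚ ![X 0 * (1 - X 0), X 0 * (1 - X 1)]

theorem logisticDerivation_X_zero : logisticDerivation (X 0) = X 0 * (1 - X 0) := by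
  simp [logisticDerivation, mkDerivation_X]

theorem logisticDerivation_X_one : logisticDerivation (X 1) = X 0 * (1 - X 1) := by
  simp [logisticDerivation, mkDerivation_X]

theorem X_mul_sum_noSuccessions (n : ℕ) :
    Polynomial.X * ∑ π ∈ noSuccessions (n + 1), (Polynomial.X : Polynomial ℝ) ^ ascCount π
      = derangementPoly (n + 1) + Polynomial.X * derangementPoly n := by
  -- Evaluation must follow the recurrences: y = 0 is incompatible with δy = x(1 - y).
  have h := congrArg (eval₂Hom (algebraMap ℚ (Polynomial ℝ)) ![Polynomial.X, 0])
    (mul_ascSuccSum logisticDerivation logisticDerivation_X_zero logisticDerivation_X_one n)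
  simpa [-coe_eval₂Hom, map_mul, map_excFixSum, map_ascSuccSum, eval₂Hom_X', excFixSum_X_zero,
    ascSuccSum_X_zero] using h

/-- The exponential generating function of the derangement polynomials. -/
theorem derangementPoly_egf_mul :
    (PowerSeries.mk fun n => algebraMap ℚ (RatFunc ℝ) (1 / n.factorial)
        * algebraMap (Polynomial ℝ) (RatFunc ℝ) (derangementPoly n))
      * (expSeries RatFunc.X - PowerSeries.C RatFunc.X * expSeries 1)
      = PowerSeries.C (1 - RatFunc.X) := by
  let φ : MvPolynomial (Fin 2) ℚ →+* RatFunc ℝ :=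
    eval₂Hom (algebraMap ℚ (RatFunc ℝ)) ![RatFunc.X, 0]
  have hx : φ (X 0) = RatFunc.X := by simp [φ]
  have hy : φ (X 1) = 0 := by simp [φ]
  have hexp (a : MvPolynomial (Fin 2) ℚ) :
      PowerSeries.map φ (PowerSeries.rescale a (PowerSeries.exp _)) = expSeries (φ a) := by
    ext n
    simp only [expSeries, PowerSeries.coeff_map, PowerSeries.coeff_rescale, PowerSeries.coeff_exp,
      map_mul, map_pow, RingHom.map_rat_algebraMap]
  have hA (n : ℕ) : φ (excFixSum (X 0) (X 1) n)
      = algebraMap (Polynomial ℝ) (RatFunc ℝ) (derangementPoly n) := by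
    rw [map_excFixSum, hx, hy, ← excFixSum_X_zero, map_excFixSum, map_zero, RatFunc.algebraMap_X]
  have h := congrArg (PowerSeries.map φ) (egf_mul_of_eulerian_recurrence logisticDerivation
    logisticDerivation_X_zero logisticDerivation_X_one (excFixSum (X 0) (X 1))
    (by simp [excFixSum])
    (excFixSum_succ logisticDerivation logisticDerivation_X_zero logisticDerivation_X_one))
  rw [map_mul, map_sub, map_mul, hexp, hexp, PowerSeries.map_C, PowerSeries.map_C] at h
  rw [map_sub, map_sub, map_sub, map_one, hx, hy, sub_zero, sub_zero] at h
  rw [← h]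
  congr 1
  ext n
  rw [PowerSeries.coeff_map, PowerSeries.coeff_mk, PowerSeries.coeff_mk, map_mul, hA,
    RingHom.map_rat_algebraMap]

end Universal

/-! ### The type B series at k = 1/2 -/

theorem seriesPow_two (F : PowerSeries (RatFunc ℝ)) (hF : PowerSeries.HasSubst (F - 1)) :
    seriesPow F 2 = F ^ 2 := by
  unfold seriesPow
  have h := PowerSeries.binomialSeries_nat (R := ℝ) (A := RatFunc ℝ) 2
  rw [Nat.cast_ofNat] at h
  rw [h, PowerSeries.subst_pow hF, PowerSeries.subst_add hF, PowerSeries.subst_X hF,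
    ← PowerSeries.coe_substAlgHom hF, map_one, add_sub_cancel]

theorem typeBDerangement_one_half (n : ℕ) :
    RatFunc.X * typeBDerangement n (1 / 2)
      = algebraMap (Polynomial ℝ) (RatFunc ℝ) (derangementPoly (n + 1))
        + RatFunc.X * algebraMap (Polynomial ℝ) (RatFunc ℝ) (derangementPoly n) := by
  set D : PowerSeries (RatFunc ℝ) := PowerSeries.mk fun n =>
    algebraMap ℚ (RatFunc ℝ) (1 / n.factorial)
      * algebraMap (Polynomial ℝ) (RatFunc ℝ) (derangementPoly n) with hD
  set E : PowerSeries (RatFunc ℝ) :=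
    expSeries RatFunc.X - PowerSeries.C RatFunc.X * expSeries 1 with hE
  have hDE : D * E = PowerSeries.C (1 - RatFunc.X) := derangementPoly_egf_mul
  have hX : (1 - RatFunc.X : RatFunc ℝ) ≠ 0 := by
    intro h
    have h2 : algebraMap (Polynomial ℝ) (RatFunc ℝ) 1
        = algebraMap (Polynomial ℝ) (RatFunc ℝ) Polynomial.X := by
      rw [map_one, RatFunc.algebraMap_X]
      exact sub_eq_zero.mp h
    have h3 := congrArg Polynomial.natDegree (RatFunc.algebraMap_injective ℝ h2)
    simp at h3
  have hc : PowerSeries.constantCoeff E ≠ 0 := by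
    have h0 (a : RatFunc ℝ) : PowerSeries.constantCoeff (expSeries a) = 1 :=
      PowerSeries.constantCoeff_rescale_exp a
    simpa [hE, h0] using hX
  have hE0 : E ≠ 0 := fun h => hc (by simp [h])
  have hder := congrArg (PowerSeries.derivative (RatFunc ℝ)) hDE
  have hE' : PowerSeries.derivative (RatFunc ℝ) E
      = PowerSeries.C RatFunc.X * (expSeries RatFunc.X - expSeries 1) := by
    rw [hE, map_sub, Derivation.leibniz, PowerSeries.derivative_C, expSeries, expSeries,
      PowerSeries.derivative_rescale_exp, PowerSeries.derivative_rescale_exp]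
    simp
    ring
  rw [Derivation.leibniz, PowerSeries.derivative_C, hE', smul_eq_mul, smul_eq_mul] at hder
  have hbase : typeBBase (1 / 2) * E
      = PowerSeries.C (1 - RatFunc.X) * expSeries (RatFunc.C (1 / 2)) := by
    have h1 : (2 * (1 / 2) : ℝ) = 1 := by norm_num
    rw [typeBBase, h1, map_one, one_mul, mul_assoc, PowerSeries.inv_mul_cancel _ hc, mul_one]
  have hexp : expSeries (RatFunc.C (1 / 2)) ^ 2 = expSeries 1 := by
    unfold expSeries
    rw [sq, PowerSeries.exp_mul_exp_eq_exp_add, ← map_add, add_halves, map_one]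
  -- Since D' = -DE'/E and E - (e^{xz} - e^z) = (1 - x)e^z, both sides equal x(1 - x)²e^z/E².
  have key : PowerSeries.C RatFunc.X * typeBBase (1 / 2) ^ 2
      = PowerSeries.derivative (RatFunc ℝ) D + PowerSeries.C RatFunc.X * D := by
    apply mul_right_cancel₀ (pow_ne_zero 2 hE0)
    have h1 : (PowerSeries.C RatFunc.X * typeBBase (1 / 2) ^ 2) * E ^ 2
        = PowerSeries.C RatFunc.X * (PowerSeries.C (1 - RatFunc.X) ^ 2 * expSeries 1) := by
      rw [mul_assoc, ← mul_pow, hbase, mul_pow, hexp]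
    rw [h1, ← hDE]
    have hC : PowerSeries.C (1 - RatFunc.X : RatFunc ℝ) = 1 - PowerSeries.C RatFunc.X := by simp
    rw [hC] at hDE
    linear_combination (PowerSeries.C RatFunc.X * expSeries 1 * D * E) * hDE - E * hder
      + (PowerSeries.C RatFunc.X * D * E) * hE
  have hcoeff := congrArg (PowerSeries.coeff n) key
  rw [map_add, PowerSeries.coeff_C_mul, PowerSeries.coeff_C_mul, PowerSeries.coeff_derivative, hD,
    PowerSeries.coeff_mk, PowerSeries.coeff_mk, mul_right_comm,
    algebraMap_one_div_factorial_succ] at hcoeff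
  have hfact : (n.factorial : RatFunc ℝ) * algebraMap ℚ (RatFunc ℝ) (1 / n.factorial) = 1 := by
    rw [← map_natCast (algebraMap ℚ (RatFunc ℝ)), ← map_mul, mul_one_div_cancel, map_one]
    exact_mod_cast n.factorial_ne_zero
  rw [typeBDerangement, one_div_one_div, seriesPow_two _ (typeBBase_hasSubst _)]
  linear_combination (n.factorial : RatFunc ℝ) * hcoeff
    + (algebraMap (Polynomial ℝ) (RatFunc ℝ) (derangementPoly (n + 1))
      + RatFunc.X * algebraMap (Polynomial ℝ) (RatFunc ℝ) (derangementPoly n)) * hfact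

theorem theorem3 (n : ℕ) (hn : 1 ≤ n) :
    typeBDerangement n (1 / 2) =
        (1 / RatFunc.X) * algebraMap (Polynomial ℝ) (RatFunc ℝ) (derangementPoly (n + 1))
          + algebraMap (Polynomial ℝ) (RatFunc ℝ) (derangementPoly n) ∧
      typeBDerangement n (1 / 2) =
        algebraMap (Polynomial ℝ) (RatFunc ℝ)
          (∑ π ∈ noSuccessions (n + 1), Polynomial.X ^ ascCount π) := by
  have hX : (RatFunc.X : RatFunc ℝ) ≠ 0 := RatFunc.X_ne_zero
  constructor
  · apply mul_left_cancel₀ hX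
    rw [typeBDerangement_one_half, mul_add, ← mul_assoc, mul_one_div_cancel hX, one_mul]
  · apply mul_left_cancel₀ hX
    rw [typeBDerangement_one_half]
    have h := congrArg (algebraMap (Polynomial ℝ) (RatFunc ℝ)) (X_mul_sum_noSuccessions n)
    rw [map_mul, map_add, map_mul, RatFunc.algebraMap_X] at h
    exact h.symm
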